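/- Let $h\ge 2$ be an integer and let $k$ be a power of $2$. Let $T^h_2$ be the full binary tree with $h$ levels and nodes $1,\dots,2^h-1$ in heap order (root $1$, children of $i$ are $2i$ and $2i+1$). An input $I$ of the tree evaluation problem $TEP^h_2(k)$ consists of a value $v_i^I\in[k]$ for each leaf $i$ and a function $f_i^I:[k]\times[k]\to[k]$ (as a table) for each internal node $i$; put $v_i^I=f_i^I(v_{2i}^I,v_{2i+1}^I)$ for internal $i$. The task is to find $v_1^I$. A ($k$-way, possibly non-deterministic) branching program is a finite directed graph whose vertices are called states. It has exactly one source, the start state. There are $k$ output states; they are sinks and are labelled with the distinct elements of $[k]$. Every other state is labelled with a query to a leaf value $v_i$ or to a table entry $f_i(x,y)$ with $i$ internal and $x,y\in[k]$. Each edge is labelled with an element of $[k]$; any number of edges, with any labels, may leave a query state. A computation path of $I$ is a path from the start state in which each edge is labelled with the result on $I$ of the query at its tail. It reaches the states on it, and it is complete if it ends at an output state. The program solves $TEP^h_2(k)$ if every input $I$ has a complete computation path and every complete computation path of $I$ ends at the output state labelled $v_1^I$. It is thrifty if every query $f_i(x,y)$ made on a complete computation path of an input $I$ satisfies $x=v_{2i}^I$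 and $y=v_{2i+1}^I$. It is bitwise-independent if for every state $\gamma$ there are sets $R_\gamma(i,l),A_\gamma(i,l)\subseteq\{0,1\}$, for each node $i$ and each bit position $1\le l\le\log_2 k$, such that for every input $I$: some computation path of $I$ reaches $\gamma$ if and only if for all $i,l$ the $l$-th bit of $v_i^I$ lies in $R_\gamma(i,l)$; and some complete computation path of $I$ passes through $\gamma$ if and only if for all $i,l$ the $l$-th bit of $v_i^I$ lies in $A_\gamma(i,l)$. (Bits are those of the binary representation with $\log_2 k$ digits, $[k]$ being identified with $\{0,\dots,k-1\}$.) Then every bitwise-independent, thrifty branching program solving $TEP^h_2(k)$, deterministic or not, has at least $k^{h/2+1}$ states. -/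

import Mathlib

namespace TreeEval

/-- The nodes of the full binary tree with `h` levels in heap order: the numbers
`1, …, 2 ^ h - 1`; the root is `1` and the children of `i` are `2 i` and `2 i + 1`. -/
abbrev Node (h : ℕ) : Type := {i : ℕ // 1 ≤ i ∧ i < 2 ^ h}

/-- The leaves, i.e. the nodes on the last level. -/
abbrev Leaf (h : ℕ) : Type := {i : ℕ // 2 ^ (h - 1) ≤ i ∧ i < 2 ^ h}

/-- The internal nodes, i.e. the nodes that are not leaves. -/
abbrev Internal (h : ℕ) : Type := {i : ℕ // 1 ≤ i ∧ i < 2 ^ (h - 1)}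

theorem two_mul_lt {h i : ℕ} (h1 : 1 ≤ i) (h2 : i < 2 ^ (h - 1)) : 2 * i + 1 < 2 ^ h := by
  cases h with
  | zero => simp at h2; omega
  | succ n => rw [Nat.add_sub_cancel] at h2; rw [pow_succ]; omega

/-- The root of a tree with at least one level. -/
def root {h : ℕ} (hh : 0 < h) : Node h :=
  ⟨1, le_rfl, Nat.one_lt_two_pow hh.ne'⟩

/-- The child `2 i` of an internal node `i`. -/
def left {h : ℕ} (i : Internal h) : Node h :=
  ⟨2 * i.1, by have := i.2.1; omega, by have := two_mul_lt i.2.1 i.2.2; omega⟩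

/-- The child `2 i + 1` of an internal node `i`. -/
def right {h : ℕ} (i : Internal h) : Node h :=
  ⟨2 * i.1 + 1, by omega, two_mul_lt i.2.1 i.2.2⟩

/-- An input to the tree evaluation problem. The set `[k]` is represented by
`Fin k = {0, …, k - 1}`. -/
structure Input (h k : ℕ) where
  /-- the value given for each leaf -/
  leaf : Leaf h → Fin k
  /-- the function given (as a table) for each internal node -/
  fn : Internal h → Fin k → Fin k → Fin k

/-- The correct value `v_i` of node `i` on the input `I`: the given number at a leaf, and
`f_i (v_{2i}, v_{2i+1})` at an internal node. -/
def Input.value {h k : ℕ} (I : Input h k) (i : Node h) : Fin k :=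
  if hl : 2 ^ (h - 1) ≤ i.1 then I.leaf ⟨i.1, hl, i.2.2⟩
  else
    I.fn ⟨i.1, i.2.1, not_le.mp hl⟩
      (I.value (left ⟨i.1, i.2.1, not_le.mp hl⟩))
      (I.value (right ⟨i.1, i.2.1, not_le.mp hl⟩))
termination_by 2 ^ h - i.1
decreasing_by
  all_goals
    have _h1 := i.2.1
    have _h2 := i.2.2
    simp only [left, right]
    omega

/-- The values of the input that a branching program may query: a leaf value `v_i`, or an
entry `f_i (x, y)` of the table of an internal node. -/
inductive Query (h k : ℕ) : Type
  | leaf (i : Leaf h)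
  | fn (i : Internal h) (x y : Fin k)

/-- The result of a query on the input `I`. -/
def Input.answer {h k : ℕ} (I : Input h k) : Query h k → Fin k
  | .leaf i => I.leaf i
  | .fn i x y => I.fn i x y

/-- A `k`-way branching program (deterministic or not) with set of states `Q`, for inputs to
the tree evaluation problem. `edge p a q` says that there is an edge labelled `a` from `p`
to `q`. There may be any number of edges with the same label out of a query state
(including none), and the directed graph may have cycles. -/
structure BranchingProgram (h k : ℕ) (Q : Type*) where
  /-- the label of a state: a query, or the output of an output state -/
  label : Q → Query h k ⊕ Fin k
  /-- the labelled edges -/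
  edge : Q → Fin k → Q → Prop
  /-- the start state -/
  start : Q
  /-- for each number in `[k]` there is exactly one output state with this label -/
  existsUnique_output : ∀ a : Fin k, ∃! q, label q = Sum.inr a
  /-- output states are sinks -/
  output_sink : ∀ q a, label q = Sum.inr a → ∀ b q', ¬ edge q b q'
  /-- the start state is the only source -/
  source_iff : ∀ q, (∀ p a, ¬ edge p a q) ↔ q = start

namespace BranchingProgram

variable {h k : ℕ} {Q : Type*}

/-- `B.Step I p q`: the state `p` makes a query, and an edge from `p` to `q` is labelled with
the result of this query on the input `I`. -/
def Step (B : BranchingProgram h k Q) (I : Input h k) (p q : Q) : Prop :=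
  ∃ x : Query h k, B.label p = Sum.inl x ∧ B.edge p (I.answer x) q

/-- Some computation path of `I` (a path from the start state whose edges are consistent
with `I`) reaches the state `γ`. -/
def Reaches (B : BranchingProgram h k Q) (I : Input h k) (γ : Q) : Prop :=
  Relation.ReflTransGen (B.Step I) B.start γ

/-- Some complete computation path of `I` (one that ends at an output state) passes through
the state `γ`. -/
def CompletesThrough (B : BranchingProgram h k Q) (I : Input h k) (γ : Q) : Prop :=
  B.Reaches I γ ∧
    ∃ (q : Q) (a : Fin k), B.label q = Sum.inr a ∧ Relation.ReflTransGen (B.Step I) γ q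

/-- The branching program solves the tree evaluation problem: every input has a complete
computation path, and every complete computation path of an input ends at the output state
labelled with the correct value of the root. -/
def Solves (B : BranchingProgram h k Q) (hh : 0 < h) : Prop :=
  ∀ I : Input h k,
    (∃ (q : Q) (a : Fin k), B.label q = Sum.inr a ∧ B.Reaches I q) ∧
    ∀ (q : Q) (a : Fin k), B.label q = Sum.inr a → B.Reaches I q → a = I.value (root hh)

/-- Every query `f_i (x, y)` to an internal node that is made on a complete computation path
of an input has the correct values of the children of `i` as its arguments. -/
def Thrifty (B : BranchingProgram h k Q) : Prop :=
  ∀ (I : Input h k) (γ : Q) (i : Internal h) (x y : Fin k),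
    B.CompletesThrough I γ → B.label γ = Sum.inl (Query.fn i x y) →
      x = I.value (left i) ∧ y = I.value (right i)

/-- Bitwise independence (meant for `k` a power of two, so that the elements of
`{0, …, k - 1}` are exactly the binary strings of length `log₂ k`): for each state `γ`, the
inputs that reach `γ` are exactly those for which each bit of each correct node value lies in
a set of bits that depends only on the state, the node and the bit position; likewise for the
inputs with a complete computation path through `γ`. -/
def BitwiseIndependent (B : BranchingProgram h k Q) : Prop :=
  ∀ γ : Q,
    (∃ R : Node h → Fin (Nat.log 2 k) → Set Bool, ∀ I : Input h k,
      B.Reaches I γ ↔ ∀ i l, Nat.testBit (I.value i : ℕ) l ∈ R i l) ∧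
    (∃ A : Node h → Fin (Nat.log 2 k) → Set Bool, ∀ I : Input h k,
      B.CompletesThrough I γ ↔ ∀ i l, Nat.testBit (I.value i : ℕ) l ∈ A i l)

end BranchingProgram

end TreeEval

/-! Call a node determined at a state if all inputs reaching the state agree on its value, and call
the state blocked if every leaf-to-root path contains a determined node. For `k > 1` the start state
is not blocked, while output states are, since the root is determined there. So every complete path
has a step into a first blocked state. By `children_mem_determined` an internal node becomes
determined only after both its children, so at that step some path is closed at its leaf alone.
`le_card_of_blocks` then gives `h` determined nodes. A state chosen for several value vectors thus
serves at most `k ^ (N - h)` of the `k ^ N` vectors, `N` being the number of nodes, which forces `k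
^ h` states. -/

namespace TreeEval

/-! ### Sets of nodes meeting all leaf-to-root paths. -/

section Combinatorics

/-- The path from the leftmost leaf `s * 2 ^ m` below `s` meets `D`; above `s` it runs along
ancestors of `l`, which avoid `D`. -/
theorem exists_mem_sibling_subtree {D : Finset ℕ} {h l m : ℕ} (hl : 2 ^ (h - 1) ≤ l)
    (hl' : l < 2 ^ h) (hanc : ∀ m, 1 ≤ m → m < h → l / 2 ^ m ∉ D)
    (hblock : ∀ l', 2 ^ (h - 1) ≤ l' → l' < 2 ^ h → ∃ m < h, l' / 2 ^ m ∈ D)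
    (hm : m + 1 < h) {s : ℕ} (hs : s / 2 = l / 2 ^ (m + 1)) :
    ∃ d ∈ D, ∃ t, d / 2 ^ t = s := by
  have hpos : 0 < 2 ^ m := by positivity
  have hdiv : l / 2 ^ (m + 1) = l / 2 ^ m / 2 := by rw [pow_succ, Nat.div_div_eq_div_mul]
  obtain ⟨r, rfl⟩ : ∃ r, h = m + 1 + (r + 1) := ⟨h - m - 2, by omega⟩
  have hlow : 2 ^ r ≤ s / 2 := by
    rw [hs, Nat.le_div_iff_mul_le (by positivity), ← pow_add]
    refine le_trans (le_of_eq ?_) hl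
    congr 1; omega
  have hup : s / 2 < 2 ^ (r + 1) := by
    rw [hs, Nat.div_lt_iff_lt_mul (by positivity), ← pow_add]
    refine lt_of_lt_of_eq hl' ?_
    congr 1; omega
  have e1 : 2 ^ (m + 1 + (r + 1) - 1) = 2 * 2 ^ r * 2 ^ m := by
    rw [show m + 1 + (r + 1) - 1 = 1 + r + m by omega, pow_add, pow_add, pow_one]
  have e2 : 2 ^ (m + 1 + (r + 1)) = 2 * 2 ^ (r + 1) * 2 ^ m := by
    rw [show m + 1 + (r + 1) = 1 + (r + 1) + m by omega, pow_add, pow_add, pow_one]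
  obtain ⟨m', hm', hmem⟩ := hblock (s * 2 ^ m)
    (by rw [e1]; exact Nat.mul_le_mul_right _ (by omega))
    (by rw [e2]; exact Nat.mul_lt_mul_of_pos_right (by omega) hpos)
  rcases le_or_gt m' m with hle | hlt
  · refine ⟨_, hmem, m - m', ?_⟩
    rw [Nat.div_div_eq_div_mul, ← pow_add, Nat.add_sub_cancel' hle, Nat.mul_div_cancel _ hpos]
  · exfalso
    obtain ⟨c, rfl⟩ := Nat.exists_eq_add_of_lt hlt
    refine hanc _ (by omega) hm' ?_
    have : l / 2 ^ (m + c + 1) = s * 2 ^ m / 2 ^ (m + c + 1) := by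
      rw [show m + c + 1 = m + 1 + c by omega, pow_add, ← Nat.div_div_eq_div_mul, ← hs,
        ← Nat.div_div_eq_div_mul, pow_succ, ← Nat.div_div_eq_div_mul (s * 2 ^ m),
        Nat.mul_div_cancel _ hpos]
    rwa [this]

theorem disjoint_sibling_subtrees {a b d t t' : ℕ} (ha : 2 ≤ a) (hab : a ≠ b)
    (h2 : a / 2 = b / 2) (hd : d / 2 ^ t = a) (hd' : d / 2 ^ t' = b) : False := by
  rcases lt_trichotomy t t' with hlt | rfl | hlt
  · obtain ⟨c, rfl⟩ := Nat.exists_eq_add_of_lt hlt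
    rw [show t + c + 1 = t + 1 + c by omega, pow_add, ← Nat.div_div_eq_div_mul, pow_succ,
      ← Nat.div_div_eq_div_mul, hd] at hd'
    have := Nat.div_le_self (a / 2) (2 ^ c)
    omega
  · exact hab (hd.symm.trans hd')
  · obtain ⟨c, rfl⟩ := Nat.exists_eq_add_of_lt hlt
    rw [show t' + c + 1 = t' + 1 + c by omega, pow_add, ← Nat.div_div_eq_div_mul, pow_succ,
      ← Nat.div_div_eq_div_mul, hd'] at hd
    have := Nat.div_le_self (b / 2) (2 ^ c)
    omega

/-- If a set of nodes meets every path from a leaf to the root, and meets one of these paths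
only in its leaf, then it has at least as many elements as the tree has levels. -/
theorem le_card_of_blocks {D : Finset ℕ} {h l : ℕ} (hh : 0 < h) (hl : 2 ^ (h - 1) ≤ l)
    (hl' : l < 2 ^ h) (hmem : l ∈ D) (hanc : ∀ m, 1 ≤ m → m < h → l / 2 ^ m ∉ D)
    (hblock : ∀ l', 2 ^ (h - 1) ≤ l' → l' < 2 ^ h → ∃ m < h, l' / 2 ^ m ∈ D) :
    h ≤ D.card := by
  classical
  -- Each step up the path from `l` gains an element from the sibling's subtree.
  have key : ∀ m, m < h → m + 1 ≤ (D.filter fun d => ∃ t, d / 2 ^ t = l / 2 ^ m).card := by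
    intro m
    induction m with
    | zero =>
      intro _
      exact Finset.card_pos.mpr ⟨l, Finset.mem_filter.mpr ⟨hmem, 0, rfl⟩⟩
    | succ m ih =>
      intro hm
      have hdiv : l / 2 ^ (m + 1) = l / 2 ^ m / 2 := by rw [pow_succ, Nat.div_div_eq_div_mul]
      have h2 : 2 ≤ l / 2 ^ m := by
        rw [Nat.le_div_iff_mul_le (by positivity), ← pow_succ']
        exact le_trans (Nat.pow_le_pow_right (by norm_num) (by omega)) hl
      obtain ⟨s, hs, hne⟩ : ∃ s, s / 2 = l / 2 ^ m / 2 ∧ l / 2 ^ m ≠ s := by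
        rcases Nat.mod_two_eq_zero_or_one (l / 2 ^ m) with hp | hp
        · exact ⟨l / 2 ^ m + 1, by omega, by omega⟩
        · exact ⟨l / 2 ^ m - 1, by omega, by omega⟩
      obtain ⟨d, hd, t, hdt⟩ :=
        exists_mem_sibling_subtree hl hl' hanc hblock hm (hs.trans hdiv.symm)
      have hnot : d ∉ D.filter fun d => ∃ t, d / 2 ^ t = l / 2 ^ m := by
        intro hd'
        obtain ⟨-, t', ht'⟩ := Finset.mem_filter.mp hd'
        exact disjoint_sibling_subtrees h2 hne hs.symm ht' hdt
      have hsub : insert d (D.filter fun d => ∃ t, d / 2 ^ t = l / 2 ^ m) ⊆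
          D.filter fun d => ∃ t, d / 2 ^ t = l / 2 ^ (m + 1) := by
        intro e he
        rcases Finset.mem_insert.mp he with rfl | he
        · exact Finset.mem_filter.mpr
            ⟨hd, t + 1, by rw [pow_succ, ← Nat.div_div_eq_div_mul, hdt, hs, hdiv]⟩
        · obtain ⟨he, t', ht'⟩ := Finset.mem_filter.mp he
          exact Finset.mem_filter.mpr
            ⟨he, t' + 1, by rw [pow_succ, ← Nat.div_div_eq_div_mul, ht', hdiv]⟩
      have := Finset.card_le_card hsub
      rw [Finset.card_insert_of_notMem hnot] at this
      have := ih (by omega)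
      omega
  have := key (h - 1) (by omega)
  have := Finset.card_filter_le D fun d => ∃ t, d / 2 ^ t = l / 2 ^ (h - 1)
  omega

end Combinatorics

/-! ### Inputs with prescribed node values. -/

section Inputs

variable {h k : ℕ}

/-- An internal node, as a node. -/
def Internal.toNode (i : Internal h) : Node h :=
  ⟨i.1, i.2.1, i.2.2.trans_le (Nat.pow_le_pow_right two_pos (Nat.sub_le _ _))⟩

/-- A leaf, as a node. -/
def Leaf.toNode (i : Leaf h) : Node h :=
  ⟨i.1, le_trans Nat.one_le_two_pow i.2.1, i.2.2⟩

theorem Input.value_leaf (I : Input h k) (i : Leaf h) : I.value i.toNode = I.leaf i := by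
  rw [Input.value, dif_pos (show 2 ^ (h - 1) ≤ i.toNode.1 from i.2.1)]
  rfl

theorem Input.value_internal (I : Input h k) (i : Internal h) :
    I.value i.toNode = I.fn i (I.value (left i)) (I.value (right i)) := by
  rw [Input.value, dif_neg (show ¬ 2 ^ (h - 1) ≤ i.toNode.1 from not_le.mpr i.2.2)]
  rfl

/-- The input with node values `u` whose other table entries are those of `I`. -/
def Input.withValues (I : Input h k) (u : Node h → Fin k) : Input h k where
  leaf i := u i.toNode
  fn i x y := if x = u (left i) ∧ y = u (right i) then u i.toNode else I.fn i x y

theorem Input.value_withValues_aux (I : Input h k) (u : Node h → Fin k) (n : ℕ) :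
    ∀ i : Node h, 2 ^ h - i.1 ≤ n → (I.withValues u).value i = u i := by
  induction n with
  | zero => intro i hi; have := i.2.2; omega
  | succ n ih =>
    intro i hi
    have h1 := i.2.1
    rcases le_or_gt (2 ^ (h - 1)) i.1 with hl | hl
    · exact (I.withValues u).value_leaf ⟨i.1, hl, i.2.2⟩
    · have := (I.withValues u).value_internal ⟨i.1, i.2.1, hl⟩
      rw [ih (left ⟨i.1, i.2.1, hl⟩) (by simp only [left]; omega),
        ih (right ⟨i.1, i.2.1, hl⟩) (by simp only [right]; omega)] at this
      refine this.trans ?_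
      simp [Input.withValues]
      rfl

@[simp]
theorem Input.value_withValues (I : Input h k) (u : Node h → Fin k) (i : Node h) :
    (I.withValues u).value i = u i :=
  I.value_withValues_aux u _ i le_rfl

end Inputs

/-! ### How nodes become determined. -/

namespace BranchingProgram

variable {h k : ℕ} {Q : Type*}

/-- The nodes whose value is the same for all inputs that reach the state `γ`. -/
def determined (B : BranchingProgram h k Q) (γ : Q) : Set (Node h) :=
  {i | ∀ I J, B.Reaches I γ → B.Reaches J γ → I.value i = J.value i}

/-- Two inputs that reach `γ` and disagree at `i` differ there in some bit, so `γ` allows both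
values of that bit, and flipping it in `u i` is harmless. -/
theorem exists_ne_reaches_update {B : BranchingProgram h k Q} (hk : ∃ n : ℕ, k = 2 ^ n)
    (hB : B.BitwiseIndependent) {γ : Q} {i : Node h} (hi : i ∉ B.determined γ)
    (u : Node h → Fin k) (hu : ∀ I : Input h k, I.value = u → B.Reaches I γ) :
    ∃ w, w ≠ u i ∧ ∀ I : Input h k, I.value = Function.update u i w → B.Reaches I γ := by
  obtain ⟨n, rfl⟩ := hk
  obtain ⟨R, hR⟩ := (hB γ).1
  have hlog : Nat.log 2 (2 ^ n) = n := Nat.log_pow Nat.one_lt_two n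
  simp only [determined, Set.mem_ofPred_eq, not_forall] at hi
  obtain ⟨I, J, hI, hJ, hne⟩ := hi
  obtain ⟨l, hl⟩ : ∃ l, Nat.testBit (I.value i : ℕ) l ≠ Nat.testBit (J.value i : ℕ) l := by
    by_contra! hcon
    exact hne (Fin.ext (Nat.eq_of_testBit_eq hcon))
  have hln : l < n := by
    by_contra! hcon
    refine hl ?_
    have hp : 2 ^ n ≤ 2 ^ l := Nat.pow_le_pow_right two_pos hcon
    rw [Nat.testBit_lt_two_pow ((I.value i).2.trans_le hp),
      Nat.testBit_lt_two_pow ((J.value i).2.trans_le hp)]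
  have hboth : ∀ b, b ∈ R i ⟨l, hlog.symm ▸ hln⟩ := by
    intro b
    have h1 := (hR I).1 hI i ⟨l, hlog.symm ▸ hln⟩
    have h2 := (hR J).1 hJ i ⟨l, hlog.symm ▸ hln⟩
    simp only at h1 h2
    revert hl h1 h2
    cases (I.value i : ℕ).testBit l <;> cases (J.value i : ℕ).testBit l <;> cases b <;> simp_all
  have hlt : (u i : ℕ) ^^^ 2 ^ l < 2 ^ n :=
    Nat.xor_lt_two_pow (u i).2 (Nat.pow_lt_pow_right Nat.one_lt_two hln)
  refine ⟨⟨(u i : ℕ) ^^^ 2 ^ l, hlt⟩, ?_, ?_⟩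
  · intro hcon
    have := congrArg (fun v : Fin (2 ^ n) => Nat.testBit v l) hcon
    simp [Nat.testBit_xor] at this
  · intro K hK
    have hu' := hu (K.withValues u) (funext fun j => by simp)
    rw [hR] at hu' ⊢
    intro j m
    have hjm := hu' j m
    rw [Input.value_withValues] at hjm
    rw [hK]
    by_cases hj : j = i
    · subst hj
      rw [Function.update_self]
      by_cases hm : (m : ℕ) = l
      · have : m = ⟨l, hlog.symm ▸ hln⟩ := Fin.ext hm
        rw [this]; exact hboth _
      · simpa [Nat.testBit_xor, Nat.testBit_two_pow, Ne.symm hm] using hjm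
    · rwa [Function.update_of_ne hj]

theorem reaches_of_value_eq {B : BranchingProgram h k Q} (hB : B.BitwiseIndependent) {γ : Q}
    {I J : Input h k} (hI : B.Reaches I γ) (hJ : J.value = I.value) : B.Reaches J γ := by
  obtain ⟨R, hR⟩ := (hB γ).1
  rw [hR] at hI ⊢
  rwa [hJ]

theorem step_of_answer_eq {B : BranchingProgram h k Q} {I J : Input h k} {p p' : Q}
    {x : Query h k} (hx : B.label p = Sum.inl x) (hs : B.Step I p p')
    (ha : J.answer x = I.answer x) : B.Step J p p' := by
  obtain ⟨y, hy, he⟩ := hs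
  obtain rfl : x = y := Sum.inl_injective (hx.symm.trans hy)
  exact ⟨x, hx, ha ▸ he⟩

/-- Along a complete computation path of a bitwise independent thrifty branching program, an
internal node becomes determined only if both of its children are. -/
theorem children_mem_determined {B : BranchingProgram h k Q} (hk : ∃ n : ℕ, k = 2 ^ n)
    (hthrifty : B.Thrifty) (hB : B.BitwiseIndependent) {I : Input h k} {p p' : Q}
    (hp : B.CompletesThrough I p) (hs : B.Step I p p') (j : Internal h)
    (hj' : j.toNode ∈ B.determined p') (hj : j.toNode ∉ B.determined p) :
    left j ∈ B.determined p ∧ right j ∈ B.determined p := by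
  have hreach : ∀ J : Input h k, J.value = I.value → B.Reaches J p :=
    fun J hJ => reaches_of_value_eq hB hp.1 hJ
  have hp' : B.Reaches I p' := hp.1.tail hs
  have contra : ∀ J : Input h k, B.Reaches J p → B.Step J p p' →
      J.value j.toNode = I.value j.toNode :=
    fun J hJ hJs => hj' J I (hJ.tail hJs) hp'
  obtain ⟨w, hw, hupd⟩ := exists_ne_reaches_update hk hB hj I.value hreach
  have hval : ∀ u : Node h → Fin k, (I.withValues u).value = u :=
    fun u => funext fun i => by simp
  obtain ⟨x, hx, -⟩ := id hs
  -- With an unchanged answer the modified input would also step to `p'`, where `j` would have two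
  -- values. Hence the query must be to `f_j`.
  have noanswer : ((I.withValues (Function.update I.value j.toNode w)).answer x) ≠
      I.answer x := by
    intro ha
    have := contra _ (hupd _ (hval _)) (step_of_answer_eq hx hs ha)
    rw [hval, Function.update_self] at this
    exact hw this
  rcases x with i | ⟨i, x, y⟩
  · exfalso
    refine noanswer ?_
    have hne : i.toNode ≠ j.toNode := by
      intro he
      have h1 : i.1 = j.1 := congrArg Subtype.val he
      have := i.2.1
      have := j.2.2
      omega
    simp only [Input.answer, Input.withValues]
    rw [Function.update_of_ne hne, Input.value_leaf]
  · obtain ⟨rfl, rfl⟩ := hthrifty I p i x y hp hx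
    by_cases hij : i = j
    · subst hij
      have child : ∀ c : Node h, (c = left i ∨ c = right i) → c ∈ B.determined p := by
        intro c hc
        by_contra hcd
        have hci : c ≠ i.toNode := by
          intro he
          have h0 := congrArg Subtype.val he
          have := i.2.1
          rcases hc with rfl | rfl <;> simp only [left, right, Internal.toNode] at h0 <;> omega
        obtain ⟨w', hw', hupd'⟩ := exists_ne_reaches_update hk hB hcd _ hupd
        rw [Function.update_of_ne hci] at hw'
        -- Changing the child as well moves the correct arguments away from the queried entry, which
        -- therefore keeps its value from `I`.
        set u := Function.update (Function.update I.value i.toNode w) c w' with hu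
        have ha : (I.withValues u).answer
              (Query.fn i (I.value (left i)) (I.value (right i))) =
            I.answer (Query.fn i (I.value (left i)) (I.value (right i))) := by
          simp only [Input.answer, Input.withValues]
          refine if_neg ?_
          rintro ⟨h1, h2⟩
          rcases hc with rfl | rfl
          · rw [hu, Function.update_self] at h1; exact hw' h1.symm
          · rw [hu, Function.update_self] at h2; exact hw' h2.symm
        have := contra _ (hupd' _ (hval _)) (step_of_answer_eq hx hs ha)
        rw [hval, hu, Function.update_of_ne hci.symm, Function.update_self] at this
        exact hw this
      exact ⟨child _ (Or.inl rfl), child _ (Or.inr rfl)⟩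
    · exfalso
      refine noanswer ?_
      have hne : i.toNode ≠ j.toNode := by
        intro he
        exact hij (Subtype.ext (show i.toNode.1 = j.toNode.1 from congrArg Subtype.val he))
      simp only [Input.answer, Input.withValues]
      rw [Function.update_of_ne hne, Input.value_internal]
      -- By thriftiness the queried entry is the correct one for `I`, so both branches give the
      -- value of `i` on `I`.
      split_ifs <;> rfl

/-! ### The step into a blocked state. -/

/-- Every leaf is determined at `γ` or has an ancestor determined at `γ`. -/
def Blocked (B : BranchingProgram h k Q) (γ : Q) : Prop :=
  ∀ l, 2 ^ (h - 1) ≤ l → l < 2 ^ h → ∃ m < h, l / 2 ^ m ∈ Subtype.val '' B.determined γ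

theorem not_blocked_start (B : BranchingProgram h k Q) (hh : 0 < h) (hk : 1 < k) :
    ¬ B.Blocked B.start := by
  intro hb
  obtain ⟨m, -, i, hi, -⟩ := hb (2 ^ (h - 1)) le_rfl
    (Nat.pow_lt_pow_right Nat.one_lt_two (by omega))
  have I : Input h k := ⟨fun _ => ⟨0, by omega⟩, fun _ _ _ => ⟨0, by omega⟩⟩
  have := hi (I.withValues fun _ => ⟨0, by omega⟩) (I.withValues fun _ => ⟨1, hk⟩)
    Relation.ReflTransGen.refl Relation.ReflTransGen.refl
  simp at this

theorem blocked_output {B : BranchingProgram h k Q} (hh : 0 < h) (hsolves : B.Solves hh) {q : Q}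
    {a : Fin k} (hq : B.label q = Sum.inr a) : B.Blocked q := by
  intro l hl hl'
  refine ⟨h - 1, by omega, root hh, ?_, ?_⟩
  · intro I J hI hJ
    exact ((hsolves I).2 q a hq hI).symm.trans ((hsolves J).2 q a hq hJ)
  · refine (Nat.div_eq_of_lt_le ?_ ?_).symm
    · simpa [root] using hl
    · rw [show (root hh).1 + 1 = 2 from rfl, ← pow_succ', Nat.sub_add_cancel hh]
      exact hl'

theorem le_card_determined_of_step {B : BranchingProgram h k Q} (hh : 0 < h)
    (hk : ∃ n : ℕ, k = 2 ^ n) (hthrifty : B.Thrifty) (hB : B.BitwiseIndependent)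
    {I : Input h k} {p p' : Q} (hp : B.CompletesThrough I p) (hs : B.Step I p p')
    (hnb : ¬ B.Blocked p) (hb : B.Blocked p') : h ≤ (B.determined p').ncard := by
  classical
  simp only [Blocked, not_forall, not_exists, not_and] at hnb
  obtain ⟨l, hl, hl', hl0⟩ := hnb
  have hfin : (Subtype.val '' B.determined p').Finite := by
    refine (Set.finite_lt_nat (2 ^ h)).subset ?_
    rintro _ ⟨i, -, rfl⟩
    exact i.2.2
  -- A proper ancestor of `l` determined at `p'` would have its child on the path determined at `p`,
  -- but that path is free of such nodes.
  have hanc : ∀ m, 1 ≤ m → m < h → l / 2 ^ m ∉ hfin.toFinset := by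
    intro m hm1 hmh hmem
    rw [Set.Finite.mem_toFinset] at hmem
    obtain ⟨j, hj, hjl⟩ := hmem
    have hjp : j ∉ B.determined p := fun hj0 => hl0 m hmh ⟨j, hj0, hjl⟩
    obtain ⟨m, rfl⟩ : ∃ m', m = m' + 1 := ⟨m - 1, by omega⟩
    have hdiv : l / 2 ^ (m + 1) = l / 2 ^ m / 2 := by rw [pow_succ, Nat.div_div_eq_div_mul]
    have hint : j.1 < 2 ^ (h - 1) := by
      rw [hjl, Nat.div_lt_iff_lt_mul (by positivity), ← pow_add]
      exact hl'.trans_le (Nat.pow_le_pow_right two_pos (by omega))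
    have hch := children_mem_determined hk hthrifty hB hp hs ⟨j.1, j.2.1, hint⟩ hj hjp
    refine hl0 m (by omega) ?_
    rcases Nat.mod_two_eq_zero_or_one (l / 2 ^ m) with hpar | hpar
    · exact ⟨_, hch.1, by simp only [left]; omega⟩
    · exact ⟨_, hch.2, by simp only [right]; omega⟩
  have hblock : ∀ l', 2 ^ (h - 1) ≤ l' → l' < 2 ^ h → ∃ m < h, l' / 2 ^ m ∈ hfin.toFinset := by
    intro l' h1 h2
    obtain ⟨m, hm, hmem⟩ := hb l' h1 h2
    exact ⟨m, hm, hfin.mem_toFinset.mpr hmem⟩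
  have hmem : l ∈ hfin.toFinset := by
    obtain ⟨m, hm, hmem⟩ := hblock l hl hl'
    rcases Nat.eq_zero_or_pos m with rfl | hpos
    · simpa using hmem
    · exact absurd hmem (hanc m hpos hm)
  have := le_card_of_blocks hh hl hl' hmem hanc hblock
  rwa [← Set.ncard_eq_toFinset_card _ hfin,
    Set.ncard_image_of_injective _ Subtype.val_injective] at this

theorem exists_reaches_le_card_determined {B : BranchingProgram h k Q} (hh : 0 < h) (hk1 : 1 < k)
    (hk : ∃ n : ℕ, k = 2 ^ n) (hsolves : B.Solves hh) (hthrifty : B.Thrifty)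
    (hB : B.BitwiseIndependent) (I : Input h k) :
    ∃ γ, B.Reaches I γ ∧ h ≤ (B.determined γ).ncard := by
  obtain ⟨q, a, hq, hIq⟩ := (hsolves I).1
  have key : ∀ p, Relation.ReflTransGen (B.Step I) p q → B.Reaches I p → ¬ B.Blocked p →
      ∃ γ, B.Reaches I γ ∧ h ≤ (B.determined γ).ncard := by
    intro p hpq
    induction hpq using Relation.ReflTransGen.head_induction_on with
    | refl => exact fun _ hnb => absurd (blocked_output hh hsolves hq) hnb
    | @head p p' hs hrest ih =>
      intro hIp hnb
      by_cases hb : B.Blocked p'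
      · exact ⟨_, hIp.tail hs, le_card_determined_of_step hh hk hthrifty hB
          ⟨hIp, q, a, hq, hrest.head hs⟩ hs hnb hb⟩
      · exact ih (hIp.tail hs) hb
  exact key B.start hIq Relation.ReflTransGen.refl (B.not_blocked_start hh hk1)

/-! ### Counting value vectors per state. -/

/-- A bitwise independent thrifty branching program for the tree evaluation problem has at
least `k ^ h` states. -/
theorem pow_height_le_card [Fintype Q] {B : BranchingProgram h k Q} (hh : 0 < h) (hk1 : 1 < k)
    (hk : ∃ n : ℕ, k = 2 ^ n) (hsolves : B.Solves hh) (hthrifty : B.Thrifty)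
    (hB : B.BitwiseIndependent) : k ^ h ≤ Fintype.card Q := by
  classical
  have : Finite (Node h) := Set.Finite.to_subtype <|
    (Set.finite_lt_nat (2 ^ h)).subset fun i hi => hi.2
  have : Fintype (Node h) := Fintype.ofFinite _
  let I₀ : Input h k := ⟨fun _ => ⟨0, by omega⟩, fun _ _ _ => ⟨0, by omega⟩⟩
  choose γ hγ hcard using fun u : Node h → Fin k =>
    exists_reaches_le_card_determined hh hk1 hk hsolves hthrifty hB (I₀.withValues u)
  have hnode : h ≤ Fintype.card (Node h) := by
    refine (hcard fun _ => ⟨0, by omega⟩).trans ?_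
    rw [← Nat.card_eq_fintype_card, ← Set.ncard_univ]
    exact Set.ncard_le_ncard (Set.subset_univ _)
  have hfib : ∀ q ∈ (Finset.univ : Finset Q),
      (Finset.univ.filter fun u => γ u = q).card ≤ k ^ (Fintype.card (Node h) - h) := by
    intro q _
    rcases (Finset.univ.filter fun u => γ u = q).eq_empty_or_nonempty with he | ⟨u₀, hu₀⟩
    · simp [he]
    have hq : h ≤ (B.determined q).ncard := by
      rw [← (Finset.mem_filter.mp hu₀).2]; exact hcard u₀
    -- Vectors assigned to `q` agree on its determined nodes, so the other coordinates tell them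
    -- apart.
    have hinj : Set.InjOn (fun (u : Node h → Fin k) (i : ↥((B.determined q)ᶜ)) => u i)
        (Finset.univ.filter fun u => γ u = q : Finset (Node h → Fin k)) := by
      intro u hu v hv huv
      rw [Finset.mem_coe, Finset.mem_filter] at hu hv
      funext i
      by_cases hi : i ∈ B.determined q
      · have := hi _ _ (hu.2 ▸ hγ u) (hv.2 ▸ hγ v)
        simpa using this
      · exact congrFun huv ⟨i, hi⟩
    have hle := Finset.card_le_card_of_injOn _ (fun u _ => Finset.mem_univ _) hinj
    refine hle.trans ?_
    rw [Finset.card_univ, Fintype.card_fun, Fintype.card_fin]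
    refine Nat.pow_le_pow_right (by omega) ?_
    rw [← Nat.card_eq_fintype_card, Nat.card_coe_set_eq, Set.ncard_compl,
      Nat.card_eq_fintype_card]
    omega
  have htotal := Finset.card_le_mul_card_image_of_maps_to
    (s := (Finset.univ : Finset (Node h → Fin k))) (t := (Finset.univ : Finset Q)) (f := γ)
    (fun u _ => Finset.mem_univ _) _ hfib
  rw [Finset.card_univ, Fintype.card_fun, Fintype.card_fin, Finset.card_univ] at htotal
  have hsplit : k ^ Fintype.card (Node h) = k ^ (Fintype.card (Node h) - h) * k ^ h := by
    rw [← pow_add, Nat.sub_add_cancel hnode]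
  rw [hsplit] at htotal
  exact Nat.le_of_mul_le_mul_left htotal (by positivity)

end BranchingProgram

end TreeEval

theorem theorem5 (h k : ℕ) (hh : 2 ≤ h) (hk : ∃ n : ℕ, k = 2 ^ n)
    {Q : Type*} [Fintype Q] (B : TreeEval.BranchingProgram h k Q)
    (hsolves : B.Solves (Nat.zero_lt_of_lt hh)) (hthrifty : B.Thrifty)
    (hbitwise : B.BitwiseIndependent) :
    (k : ℝ) ^ ((h : ℝ) / 2 + 1) ≤ (Fintype.card Q : ℝ) := by
  have hpos : 0 < k := by
    obtain ⟨n, rfl⟩ := hk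
    positivity
  rcases (Nat.succ_le_of_lt hpos).eq_or_lt with h1 | h1
  -- For `k = 1` the bound is 1, and the start state suffices.
  · have : 0 < Fintype.card Q := Fintype.card_pos_iff.mpr ⟨B.start⟩
    rw [← h1]
    simpa using Nat.succ_le_of_lt this
  · have hcard := TreeEval.BranchingProgram.pow_height_le_card _ h1 hk hsolves hthrifty hbitwise
    -- This is exactly what makes `h / 2 + 1 ≤ h`.
    have h2 : (2 : ℝ) ≤ h := by exact_mod_cast hh
    calc (k : ℝ) ^ ((h : ℝ) / 2 + 1) ≤ (k : ℝ) ^ (h : ℝ) :=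
          Real.rpow_le_rpow_of_exponent_le (by exact_mod_cast hpos) (by linarith)
      _ = ((k ^ h : ℕ) : ℝ) := by rw [Real.rpow_natCast, Nat.cast_pow]
      _ ≤ Fintype.card Q := by exact_mod_cast hcard
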